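/- **Setting.** *Field.* Let $\mathcal D'$ be the space of real distributions on $\mathbb C$ with the σ-algebra generated by the pairings with test functions. A *whole-plane GFF* is a random element $h$ of $\mathcal D'$ such that the pairings $(h,\phi)$, $\phi\in C_c^\infty(\mathbb C)$, are jointly Gaussian and centered with $$\operatorname{Cov}((h,\phi),(h,\psi))=\int_{\mathbb C\times\mathbb C}\phi(z)\psi(w)\log\frac{\max\{|z|,1\}\max\{|w|,1\}}{|z-w|}\,d^2z\,d^2w .$$ A *GFF plus a continuous function* is $h+f$ with $h$ a whole-plane GFF and $f:\mathbb C\to\mathbb R$ a (possibly random and $h$-dependent) continuous function. *Parameters.* Let $\gamma\in(0,2)$, $Q=2/\gamma+\gamma/2$ and $\xi=\gamma/d_\gamma$, where $d_\gamma>0$ is the dimension of $\gamma$-LQG, characterized as follows: if, for $\varepsilon>0$, $\mathfrak a_\varepsilon$ is the median of the infimum of $\int_0^1 e^{\xi h^*_\varepsilon(P(t))}|P'(t)|\,dt$ over all piecewise continuously differentiable paths $P:[0,1]\to[0,1]^2$ joining the left and right sides of the unit square, where $h$ is a whole-plane GFF and $h^*_\varepsilon$ is its convolution with the heat kernel $p_{\varepsilon^2/2}$,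 $p_t(z)=\frac1{2\pi t}e^{-|z|^2/2t}$, then $\mathfrak a_\varepsilon=\varepsilon^{1-\xi Q+o(1)}$ as $\varepsilon\to0$. *Lengths.* For a metric $\mathfrak d$ on $\mathbb C$, $\operatorname{len}(P;\mathfrak d)$ denotes the $\mathfrak d$-length of a continuous path $P$, i.e. the supremum over partitions $a=t_0<\dots<t_n=b$ of its domain $[a,b]$ of $\sum_i\mathfrak d(P(t_i),P(t_{i-1}))$. For open $U$, the internal metric $\mathfrak d(z,w;U)$ is the infimum of the $\mathfrak d$-lengths of the paths from $z$ to $w$ in $U$. A *length metric* is a metric with $\mathfrak d(z,w)=\mathfrak d(z,w;\mathbb C)$ for all $z,w$. A *$\mathfrak d$-geodesic* from $z$ to $w$ is a path from $z$ to $w$ of minimal $\mathfrak d$-length. *LQG metric.* A *$\gamma$-LQG metric* is a measurable map $h\mapsto D_h$ from $\mathcal D'$ to the metrics on $\mathbb C$ inducing the Euclidean topology (i.e. each $h\mapsto D_h(z,w)$ is measurable) such that, whenever $h$ is a GFF plus a continuous function: 1. almost surely, $D_h$ is a length metric; 2. for each deterministic open $U\subset\mathbb C$, the internal metric $D_h(\cdot,\cdot;U)$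 is almost surely given by a measurable function of $h|_U$; 3. almost surely, for every continuous $f:\mathbb C\to\mathbb R$ and all $z,w\in\mathbb C$, $$D_{h+f}(z,w)=\inf_P\int_0^{\operatorname{len}(P;D_h)}e^{\xi f(P(t))}\,dt,$$ the infimum being over the paths $P$ from $z$ to $w$ parametrized by $D_h$-length; 4. for each deterministic $r>0$ and $z\in\mathbb C$, almost surely $D_h(ru+z,rv+z)=D_{h(r\cdot+z)+Q\log r}(u,v)$ for all $u,v\in\mathbb C$. **Lemma.** Let $\gamma\in(0,2)$, let $h$ be a whole-plane GFF and let $D_h$ be its metric under a $\gamma$-LQG metric. Let $z,w\in\mathbb C$ and let $U\subset\mathbb C$ be a connected open set containing $z$ and $w$. Then with positive probability every $D_h$-geodesic from $z$ to $w$ is contained in $U$; that is, there is a (measurable) event of positive probability on which all $D_h$-geodesics from $z$ to $w$ stay in $U$. -/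

import Mathlib

open MeasureTheory ProbabilityTheory Filter Topology Set TopologicalSpace
open scoped ENNReal Distributions

namespace LQG

noncomputable section

/-! ### Distributions on the plane and on open subsets of it -/

/-- Real test functions on the plane (smooth, compactly supported). -/
abbrev PlaneTest : Type := 𝓓((⊤ : Opens ℂ), ℝ)

/-- The space of real distributions (generalized functions) on the plane. -/
abbrev PlaneDistribution : Type := 𝓓'((⊤ : Opens ℂ), ℝ)

/-- The σ-algebra on a space of distributions generated by the pairings with test functions.
It is the Borel σ-algebra of the weak topology. -/
instance instMeasurableSpaceDistribution (U : Opens ℂ) : MeasurableSpace 𝓓'(U, ℝ) :=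
  ⨆ φ : 𝓓(U, ℝ), MeasurableSpace.comap (fun T : 𝓓'(U, ℝ) => T φ) (borel ℝ)

/-- The restriction `T|_U` of a distribution to an open set `U`. -/
def restrictTo (U : Opens ℂ) (T : PlaneDistribution) : 𝓓'(U, ℝ) :=
  ContinuousLinearMap.precompCompactConvergenceCLM ℝ
    (TestFunction.monoCLM ℝ : 𝓓(U, ℝ) →L[ℝ] PlaneTest) T

theorem locallyIntegrableOn_continuousMap (f : C(ℂ, ℝ)) :
    LocallyIntegrableOn (f : ℂ → ℝ) ((⊤ : Opens ℂ) : Set ℂ) volume :=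
  f.continuous.locallyIntegrable.locallyIntegrableOn _

/-- A continuous function `f`, regarded as the distribution `φ ↦ ∫ φ f`. -/
def ofFun (f : C(ℂ, ℝ)) : PlaneDistribution :=
  ContinuousLinearMap.toUniformConvergenceCLM (RingHom.id ℝ) ℝ _
    (TestFunction.integralAgainstBilinCLM (ContinuousLinearMap.mul ℝ ℝ) volume f)

theorem ofFun_apply (f : C(ℂ, ℝ)) (φ : PlaneTest) :
    ofFun f φ = ∫ x, φ x * f x := by
  show TestFunction.integralAgainstBilinCLM (ContinuousLinearMap.mul ℝ ℝ) volume f φ = _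
  rw [TestFunction.integralAgainstBilinCLM_eq_integral (locallyIntegrableOn_continuousMap f)]
  rfl

/-- The test function `x ↦ φ ((x - z) / r)`. -/
def affineTest (r : ℝ) (hr : 0 < r) (z : ℂ) (φ : PlaneTest) : PlaneTest where
  toFun x := φ (r⁻¹ • (x - z))
  contDiff' := φ.contDiff.comp (by fun_prop)
  hasCompactSupport' := by
    have := φ.hasCompactSupport.comp_homeomorph
      ((Homeomorph.subRight z).trans (Homeomorph.smulOfNeZero r⁻¹ (inv_ne_zero hr.ne')))
    exact this
  tsupport_subset' := fun _ _ => trivial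

theorem iteratedFDeriv_affine (i : ℕ) (r : ℝ) (z : ℂ) {φ : ℂ → ℝ} (hφ : ContDiff ℝ ((⊤ : ℕ∞) : WithTop ℕ∞) φ) (x : ℂ) :
    iteratedFDeriv ℝ i (fun x => φ (r⁻¹ • (x - z))) x
      = r⁻¹ ^ i • iteratedFDeriv ℝ i φ (r⁻¹ • (x - z)) := by
  have h1 := iteratedFDeriv_comp_sub (𝕜 := ℝ) (f := fun y : ℂ => φ (r⁻¹ • y)) i z x
  rw [h1]
  have h2 := iteratedFDeriv_comp_const_smul (𝕜 := ℝ) (i := i) r⁻¹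
    (hφ.of_le (by exact_mod_cast le_top))
  exact congrFun h2 _

/-- `φ ↦ φ ((· - z) / r)` as a continuous linear map on test functions. -/
def affineTestCLM (r : ℝ) (hr : 0 < r) (z : ℂ) : PlaneTest →L[ℝ] PlaneTest :=
  TestFunction.limitCLM ℝ (affineTest r hr z)
    (fun K _ =>
      let K' : Compacts ℂ := K.map (fun y => r • y + z) (by fun_prop)
      (TestFunction.ofSupportedInCLM ℝ (fun _ _ => trivial : (K' : Set ℂ) ⊆ (⊤ : Opens ℂ))) ∘L
        (ContDiffMapSupportedIn.mkCLM ℝ (K₂ := K') (fun φ x => φ (r⁻¹ • (x - z)))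
          (fun _ _ _ => rfl) (fun _ _ _ => rfl)
          (fun φ => φ.contDiff.comp (by fun_prop))
          (fun φ x hx => φ.zero_on_compl (fun h => hx ⟨_, h, by
            simp [hr.ne']⟩))
          (fun i _ => ⟨{i}, (r⁻¹) ^ i, by positivity, fun φ x _ => by
            rw [iteratedFDeriv_affine i r z φ.contDiff x, norm_smul, norm_pow,
              Real.norm_of_nonneg (by positivity : 0 ≤ r⁻¹), Finset.sup_singleton]
            gcongr
            exact ContDiffMapSupportedIn.norm_iteratedFDeriv_apply_le_seminorm_top ℝ⟩)))
    (fun _ _ _ => rfl)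

/-- The rescaled distribution `T (r · + z)`: its pairing with `φ` is
`r⁻² (T, φ ((· - z) / r))`. -/
def affinePullback (r : ℝ) (hr : 0 < r) (z : ℂ) (T : PlaneDistribution) : PlaneDistribution :=
  (r ^ 2)⁻¹ • ContinuousLinearMap.precompCompactConvergenceCLM ℝ (affineTestCLM r hr z) T

theorem affinePullback_apply (r : ℝ) (hr : 0 < r) (z : ℂ) (T : PlaneDistribution)
    (φ : PlaneTest) :
    affinePullback r hr z T φ = (r ^ 2)⁻¹ * T (affineTest r hr z φ) := rfl

/-! ### The whole-plane Gaussian free field -/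

/-- The covariance kernel of the whole-plane Gaussian free field, normalized so that its average
over the unit circle is zero. -/
def greenKernel (z w : ℂ) : ℝ :=
  Real.log (max ‖z‖ 1 * max ‖w‖ 1 / ‖z - w‖)

/-- `h` is a whole-plane Gaussian free field: a random distribution whose pairings with test
functions are jointly Gaussian and centered, with covariance kernel `greenKernel`. -/
structure IsWholePlaneGFF {Ω : Type*} [MeasurableSpace Ω] (h : Ω → PlaneDistribution)
    (P : Measure Ω) : Prop where
  measurable : Measurable h
  gaussian : IsGaussianProcess (fun (φ : PlaneTest) (ω : Ω) => h ω φ) P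
  centered : ∀ φ : PlaneTest, ∫ ω, h ω φ ∂P = 0
  covariance_eq : ∀ φ ψ : PlaneTest,
    covariance (fun ω => h ω φ) (fun ω => h ω ψ) P
      = ∫ p : ℂ × ℂ, φ p.1 * ψ p.2 * greenKernel p.1 p.2

/-- `h` is a whole-plane Gaussian free field plus a (possibly random, and possibly dependent on
the field) continuous function. -/
def IsGFFPlusContinuous {Ω : Type*} [MeasurableSpace Ω] (h : Ω → PlaneDistribution)
    (P : Measure Ω) : Prop :=
  ∃ (h₀ : Ω → PlaneDistribution) (f : Ω → C(ℂ, ℝ)), IsWholePlaneGFF h₀ P ∧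
    (∀ z, Measurable fun ω => f ω z) ∧ ∀ ω, h ω = h₀ ω + ofFun (f ω)

/-! ### Liouville first passage percolation and the dimension `d_γ` -/

/-- The heat kernel `p_t(z) = exp (-|z|² / 2t) / (2πt)`. -/
def heatKernel (t : ℝ) (z : ℂ) : ℝ :=
  (2 * Real.pi * t)⁻¹ * Real.exp (-‖z‖ ^ 2 / (2 * t))

/-- A smooth cutoff, equal to `1` on the disk of radius `n + 1` about `0` and supported in the
disk of radius `2 (n + 1)`. -/
def cutoff (n : ℕ) : ContDiffBump (0 : ℂ) where
  rIn := n + 1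
  rOut := 2 * (n + 1)
  rIn_pos := by positivity
  rIn_lt_rOut := by linarith [(Nat.cast_nonneg n : (0 : ℝ) ≤ n)]

/-- The function `x ↦ p_t (z - x)`, cut off at radius about `n` to make it a test function. -/
def heatTest (n : ℕ) (t : ℝ) (z : ℂ) : PlaneTest where
  toFun x := cutoff n x * heatKernel t (z - x)
  contDiff' := by
    have h1 : ContDiff ℝ ((⊤ : ℕ∞) : WithTop ℕ∞) (fun x : ℂ => ‖z - x‖ ^ 2) := (contDiff_const.sub contDiff_id).norm_sq ℝ
    have h2 : ContDiff ℝ ((⊤ : ℕ∞) : WithTop ℕ∞) (fun x : ℂ => heatKernel t (z - x)) :=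
      contDiff_const.mul (Real.contDiff_exp.comp (h1.neg.div_const _))
    exact (cutoff n).contDiff.mul h2
  hasCompactSupport' := (cutoff n).hasCompactSupport.mul_right
  tsupport_subset' := fun _ _ => trivial

/-- The mollification `T * p_{ε²/2}` of a distribution. The heat kernel is not compactly
supported, so the pairing of `T` with `p_{ε²/2} (z - ·)` is the limit of the pairings with its
cutoffs (for the whole-plane Gaussian free field this limit exists for all `z`, almost surely). -/
def heatMollify (ε : ℝ) (T : PlaneDistribution) (z : ℂ) : ℝ :=
  limUnder atTop fun n : ℕ => T (heatTest n (ε ^ 2 / 2) z)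

/-- `P` is piecewise continuously differentiable on `[0, 1]`. -/
def IsPiecewiseC1 (P : ℝ → ℂ) : Prop :=
  ContinuousOn P (Icc 0 1) ∧ ∃ (n : ℕ) (t : ℕ → ℝ), Monotone t ∧ t 0 = 0 ∧ t n = 1 ∧
    ∀ i < n, ContDiffOn ℝ 1 P (Icc (t i) (t (i + 1)))

/-- `P` is a left-right crossing of the unit square `[0, 1]²`. -/
def IsLeftRightCrossing (P : ℝ → ℂ) : Prop :=
  IsPiecewiseC1 P ∧ (∀ t ∈ Icc (0 : ℝ) 1, (P t).re ∈ Icc (0 : ℝ) 1 ∧ (P t).im ∈ Icc (0 : ℝ) 1) ∧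
    (P 0).re = 0 ∧ (P 1).re = 1

/-- The Liouville first passage percolation distance, with parameter `ξ` and scale `ε`, between
the left and right sides of the unit square, along paths in the square. -/
def crossingDist (ξ ε : ℝ) (T : PlaneDistribution) : ℝ≥0∞ :=
  ⨅ (P : ℝ → ℂ) (_ : IsLeftRightCrossing P),
    ∫⁻ t in Icc (0 : ℝ) 1, ENNReal.ofReal (Real.exp (ξ * heatMollify ε T (P t)) * ‖deriv P t‖)

/-- `m` is a median of `X` under `μ`. -/
def IsMedian {Ω : Type*} [MeasurableSpace Ω] (μ : Measure Ω) (X : Ω → ℝ≥0∞) (m : ℝ) : Prop :=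
  1 / 2 ≤ μ {ω | X ω ≤ ENNReal.ofReal m} ∧ 1 / 2 ≤ μ {ω | ENNReal.ofReal m ≤ X ω}

/-- `a ε` is, for every `ε > 0`, the median crossing distance of the unit square for Liouville
first passage percolation with parameter `ξ` driven by a whole-plane Gaussian free field. -/
def IsLFPPNormalization (ξ : ℝ) (a : ℝ → ℝ) : Prop :=
  ∃ μ : Measure PlaneDistribution, IsProbabilityMeasure μ ∧ IsWholePlaneGFF (fun T => T) μ ∧
    ∀ ε : ℝ, 0 < ε → 0 < a ε ∧ IsMedian μ (crossingDist ξ ε) (a ε)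

/-- The constant `Q = 2/γ + γ/2`. -/
def coordQ (γ : ℝ) : ℝ := 2 / γ + γ / 2

/-- `d` is the dimension `d_γ` of `γ`-Liouville quantum gravity: for the parameter `ξ = γ / d`,
the normalizing constants of Liouville first passage percolation satisfy
`a ε = ε ^ (1 - ξ Q + o(1))` as `ε → 0`, where `Q = 2/γ + γ/2`. -/
def IsLQGDimension (γ d : ℝ) : Prop :=
  0 < d ∧ ∃ a : ℝ → ℝ, IsLFPPNormalization (γ / d) a ∧
    Tendsto (fun ε => Real.log (a ε) / Real.log ε) (𝓝[>] 0) (𝓝 (1 - γ / d * coordQ γ))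

/-! ### Metrics on the plane, lengths of paths, geodesics -/

/-- `d` is a metric on the plane which induces the Euclidean topology. -/
structure IsPlaneMetric (d : ℂ → ℂ → ℝ) : Prop where
  eq_zero_iff : ∀ z w, d z w = 0 ↔ z = w
  symm : ∀ z w, d z w = d w z
  triangle : ∀ x y z, d x z ≤ d x y + d y z
  isOpen_iff : ∀ s : Set ℂ, IsOpen s ↔ ∀ z ∈ s, ∃ r > 0, ∀ w, d z w < r → w ∈ s

/-- `P : [a, b] → ℂ` is a path from `z` to `w`. -/
def IsPath (P : ℝ → ℂ) (a b : ℝ) (z w : ℂ) : Prop :=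
  a ≤ b ∧ ContinuousOn P (Icc a b) ∧ P a = z ∧ P b = w

/-- The `d`-length of `P : [a, b] → ℂ`, the supremum over the partitions
`a = t 0 ≤ ⋯ ≤ t n = b` of the sum of `d (P (t (i + 1))) (P (t i))`. -/
def pathLength (d : ℂ → ℂ → ℝ) (P : ℝ → ℂ) (a b : ℝ) : ℝ≥0∞ :=
  ⨆ (n : ℕ) (t : ℕ → ℝ) (_ : Monotone t ∧ t 0 = a ∧ t n = b),
    ∑ i ∈ Finset.range n, ENNReal.ofReal (d (P (t (i + 1))) (P (t i)))

/-- The internal metric of `d` on `U`: the infimum of the `d`-lengths of the paths in `U`. -/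
def internalDist (d : ℂ → ℂ → ℝ) (U : Set ℂ) (z w : ℂ) : ℝ≥0∞ :=
  ⨅ (P : ℝ → ℂ) (a : ℝ) (b : ℝ) (_ : IsPath P a b z w ∧ ∀ t ∈ Icc a b, P t ∈ U),
    pathLength d P a b

/-- `d` is a length metric. -/
def IsLengthMetric (d : ℂ → ℂ → ℝ) : Prop :=
  ∀ z w, ENNReal.ofReal (d z w) = internalDist d univ z w

/-- The metric `e^{ξ f} · d`: the infimum of `∫ e^{ξ f(P(t))} dt` over the paths `P` from `z` to
`w` parametrized by `d`-length. -/
def weylScale (ξ : ℝ) (f : C(ℂ, ℝ)) (d : ℂ → ℂ → ℝ) (z w : ℂ) : ℝ≥0∞ :=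
  ⨅ (P : ℝ → ℂ) (L : ℝ)
    (_ : IsPath P 0 L z w ∧ ∀ t ∈ Icc 0 L, pathLength d P 0 t = ENNReal.ofReal t),
    ∫⁻ t in Icc 0 L, ENNReal.ofReal (Real.exp (ξ * f (P t)))

/-- `P : [a, b] → ℂ` is a `d`-geodesic from `z` to `w`: a path from `z` to `w` of minimal
`d`-length. -/
def IsGeodesic (d : ℂ → ℂ → ℝ) (P : ℝ → ℂ) (a b : ℝ) (z w : ℂ) : Prop :=
  IsPath P a b z w ∧ ∀ (P' : ℝ → ℂ) (a' b' : ℝ), IsPath P' a' b' z w →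
    pathLength d P a b ≤ pathLength d P' a' b'

/-! ### The LQG metric -/

/-- `T ↦ D T` is a `γ`-LQG metric, where `d` is the dimension of `γ`-LQG and `ξ = γ / d`: a
measurable map from distributions to metrics on the plane inducing the Euclidean topology (where
measurability of metrics is tested on the distances between pairs of points), with the following
properties whenever `h` is a whole-plane Gaussian free field plus a continuous function. -/
structure IsLQGMetric.{u} (γ d : ℝ) (D : PlaneDistribution → ℂ → ℂ → ℝ) : Prop where
  isPlaneMetric : ∀ T, IsPlaneMetric (D T)
  measurable : ∀ z w, Measurable fun T => D T z w
  /-- Length space. -/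
  length_space : ∀ (Ω : Type u) [MeasurableSpace Ω] (P : Measure Ω) [IsProbabilityMeasure P]
    (h : Ω → PlaneDistribution), IsGFFPlusContinuous h P →
    ∀ᵐ ω ∂P, IsLengthMetric (D (h ω))
  /-- Locality: the internal metric on a deterministic open set `U` is almost surely given by a
  measurable function of the restriction of the field to `U`. -/
  locality : ∀ (Ω : Type u) [MeasurableSpace Ω] (P : Measure Ω) [IsProbabilityMeasure P]
    (h : Ω → PlaneDistribution), IsGFFPlusContinuous h P → ∀ U : Opens ℂ,
    ∃ F : 𝓓'(U, ℝ) → ℂ → ℂ → ℝ≥0∞, (∀ z ∈ U, ∀ w ∈ U, Measurable fun S => F S z w) ∧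
      ∀ᵐ ω ∂P, ∀ z ∈ U, ∀ w ∈ U, internalDist (D (h ω)) U z w = F (restrictTo U (h ω)) z w
  /-- Weyl scaling. -/
  weyl_scaling : ∀ (Ω : Type u) [MeasurableSpace Ω] (P : Measure Ω) [IsProbabilityMeasure P]
    (h : Ω → PlaneDistribution), IsGFFPlusContinuous h P →
    ∀ᵐ ω ∂P, ∀ (f : C(ℂ, ℝ)) (z w : ℂ),
      weylScale (γ / d) f (D (h ω)) z w = ENNReal.ofReal (D (h ω + ofFun f) z w)
  /-- Coordinate change for scaling and translation. -/
  coordinate_change : ∀ (Ω : Type u) [MeasurableSpace Ω] (P : Measure Ω) [IsProbabilityMeasure P]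
    (h : Ω → PlaneDistribution), IsGFFPlusContinuous h P → ∀ (r : ℝ) (hr : 0 < r) (z : ℂ),
    ∀ᵐ ω ∂P, ∀ u v : ℂ, D (h ω) (r * u + z) (r * v + z)
      = D (affinePullback r hr z (h ω) + ofFun (.const ℂ (coordQ γ * Real.log r))) u v

end

end LQG

universe u

open LQG

namespace LQG

/-! ### Plane metrics and lengths of paths -/

section Metric

variable {d : ℂ → ℂ → ℝ}

/-! A Cameron-Martin shift of the field can make a compact connected set `K ⊆ U` joining `z` to `w`
arbitrarily cheap relative to leaving a neighbourhood `V ⊆ U` of it. Take a continuous `g` with `g <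
c₀` on `K` and `g = c₀` off a compact `C ⊆ V`. By Weyl scaling, the metric of `h + n g` multiplied
by `e^{-ξ n c₀}` sends the distance from `z` to `w` to `0`, since a chain of small balls covers `K`.
Every path from `z` to the frontier of `V` must cross a collar where `g = c₀`, so its rescaled
length stays bounded below (`eventually_lt_frontier`). Hence almost surely some `h + n g` lies in
the event `E` that `w` is closer to `z` than the frontier of `V`. In a length metric this confines
the geodesics to `V`.

If `h` had probability zero of lying in `E`, so would every `h + n g`, because the law of `h + n g`
is absolutely continuous with respect to that of `h`; a countable union contradicts the previous
paragraph.

Absolute continuity follows from a one-dimensional Gaussian shift, once `g` represents the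
covariance with a single pairing `(h, ψ)`. For `ψ` of mean zero this says that `g` is a constant
minus the logarithmic potential of `ψ`. Suitable potentials are sums of radial bumps, compactly
supported by Newton's theorem. -/

theorem IsPlaneMetric.dist_self (hd : IsPlaneMetric d) (z : ℂ) : d z z = 0 :=
  (hd.eq_zero_iff z z).2 rfl

theorem IsPlaneMetric.nonneg (hd : IsPlaneMetric d) (z w : ℂ) : 0 ≤ d z w := by
  have h := hd.triangle z w z
  rw [hd.dist_self, hd.symm w z] at h
  linarith

theorem IsPlaneMetric.isOpen_ball (hd : IsPlaneMetric d) (z : ℂ) (r : ℝ) :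
    IsOpen {w | d z w < r} := by
  refine (hd.isOpen_iff _).2 fun x hx => ⟨r - d z x, sub_pos.2 hx, fun w hw => ?_⟩
  show d z w < r
  linarith [hd.triangle z x w]

theorem IsPlaneMetric.ball_mem_nhds (hd : IsPlaneMetric d) (z : ℂ) {r : ℝ} (hr : 0 < r) :
    {w | d z w < r} ∈ 𝓝 z :=
  (hd.isOpen_ball z r).mem_nhds (by simpa [hd.dist_self] using hr)

/-- A compact set and a disjoint closed set are at positive distance. -/
theorem IsPlaneMetric.exists_pos_le (hd : IsPlaneMetric d) {K C : Set ℂ} (hK : IsCompact K)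
    (hC : IsClosed C) (h : Disjoint K C) : ∃ c > 0, ∀ x ∈ K, ∀ y ∈ C, c ≤ d x y := by
  refine hK.induction_on (p := fun s => ∃ c > 0, ∀ x ∈ s, ∀ y ∈ C, c ≤ d x y)
    ⟨1, one_pos, by simp⟩ ?_ ?_ ?_
  · rintro s t hst ⟨c, hc, h⟩
    exact ⟨c, hc, fun x hx => h x (hst hx)⟩
  · rintro s t ⟨c, hc, h⟩ ⟨c', hc', h'⟩
    refine ⟨min c c', lt_min hc hc', ?_⟩
    rintro x (hx | hx) y hy
    · exact (min_le_left _ _).trans (h x hx y hy)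
    · exact (min_le_right _ _).trans (h' x hx y hy)
  · intro x hx
    obtain ⟨r, hr, hrx⟩ := (hd.isOpen_iff _).1 hC.isOpen_compl x (h.notMem_of_mem_left hx)
    refine ⟨_, mem_nhdsWithin_of_mem_nhds (hd.ball_mem_nhds x (half_pos hr)), r / 2, half_pos hr,
      fun x' hx' y hy => ?_⟩
    have h1 : r ≤ d x y := not_lt.1 fun h => hrx y h hy
    have h2 : d x x' < r / 2 := hx'
    linarith [hd.triangle x x' y]

theorem dist_le_pathLength (d : ℂ → ℂ → ℝ) (p : ℝ → ℂ) {a b : ℝ} (hab : a ≤ b) :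
    ENNReal.ofReal (d (p b) (p a)) ≤ pathLength d p a b := by
  refine le_trans ?_ (le_iSup_of_le 1 (le_iSup_of_le (fun n => if n = 0 then a else b)
    (le_iSup_of_le ⟨?_, by simp, by simp⟩ le_rfl)))
  · simp
  · intro m n hmn
    by_cases hm : m = 0
    · by_cases hn : n = 0 <;> simp [hm, hn, hab]
    · simp [hm, show n ≠ 0 by omega]

/-- Appending the point `c` to a partition of `[a, b]` gives a partition of `[a, c]`. -/
theorem pathLength_add_dist_le (d : ℂ → ℂ → ℝ) (p : ℝ → ℂ) {a b c : ℝ} (hab : a ≤ b)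
    (hbc : b ≤ c) :
    pathLength d p a b + ENNReal.ofReal (d (p c) (p b)) ≤ pathLength d p a c := by
  have key : ∀ (n : ℕ) (t : ℕ → ℝ), Monotone t → t 0 = a → t n = b →
      ∑ i ∈ Finset.range n, ENNReal.ofReal (d (p (t (i + 1))) (p (t i)))
        + ENNReal.ofReal (d (p c) (p b)) ≤ pathLength d p a c := by
    intro n t ht h0 hn
    refine le_trans (le_of_eq ?_) (le_iSup_of_le (n + 1)
      (le_iSup_of_le (fun i => if i ≤ n then t i else c)
        (le_iSup_of_le ⟨?_, by simp [h0], by simp⟩ le_rfl)))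
    · rw [Finset.sum_range_succ]
      congr 1
      · refine Finset.sum_congr rfl fun i hi => ?_
        have hi := Finset.mem_range.1 hi
        dsimp only
        rw [if_pos (by omega), if_pos (by omega)]
      · simp [hn]
    · intro i j hij
      by_cases hj : j ≤ n
      · simpa [hj, hij.trans hj] using ht hij
      · by_cases hi : i ≤ n
        · simpa [hj, hi] using (ht hi).trans (hn.trans_le hbc)
        · simp [hj, hi]
  -- This bound makes the truncated subtraction below exact, so that the supremum over partitions of
  -- `[a, b]` can be taken on its own.
  have h1 : ENNReal.ofReal (d (p c) (p b)) ≤ pathLength d p a c := by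
    refine le_trans (le_add_self) (key 1 (fun n => if n = 0 then a else b) ?_ (by simp) (by simp))
    intro m n hmn
    by_cases hm : m = 0
    · by_cases hn : n = 0 <;> simp [hm, hn, hab]
    · simp [hm, show n ≠ 0 by omega]
  rw [← tsub_add_cancel_of_le h1]
  gcongr
  exact iSup_le fun n => iSup_le fun t => iSup_le fun ht =>
    ENNReal.le_sub_of_add_le_right ENNReal.ofReal_ne_top (key n t ht.1 ht.2.1 ht.2.2)

theorem pathLength_mono_right (d : ℂ → ℂ → ℝ) (p : ℝ → ℂ) {a b c : ℝ} (hab : a ≤ b)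
    (hbc : b ≤ c) : pathLength d p a b ≤ pathLength d p a c :=
  le_self_add.trans (pathLength_add_dist_le d p hab hbc)

/-- A continuous path in the plane that starts in an open set and leaves it meets its frontier. -/
theorem exists_mem_frontier {p : ℝ → ℂ} {a t : ℝ} (hat : a ≤ t) (hp : ContinuousOn p (Icc a t))
    {V : Set ℂ} (ha : p a ∈ V) (ht : p t ∉ V) : ∃ s ∈ Icc a t, p s ∈ frontier V := by
  by_contra! h
  have hcov : p '' Icc a t ⊆ interior V ∪ (closure V)ᶜ := by
    rintro _ ⟨s, hs, rfl⟩
    by_contra hn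
    simp only [mem_union, mem_compl_iff, not_or, not_not] at hn
    exact h s hs ⟨hn.2, hn.1⟩
  have ha' : p a ∈ p '' Icc a t := mem_image_of_mem p (left_mem_Icc.2 hat)
  have ht' : p t ∈ p '' Icc a t := mem_image_of_mem p (right_mem_Icc.2 hat)
  obtain ⟨x, -, hx1, hx2⟩ := (isPreconnected_Icc.image p hp) _ _ isOpen_interior
    isClosed_closure.isOpen_compl hcov
    ⟨p a, ha', (hcov ha').resolve_right fun h => h (subset_closure ha)⟩
    ⟨p t, ht', (hcov ht').resolve_left fun h => ht (interior_subset h)⟩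
  exact hx2 (subset_closure (interior_subset hx1))

/-- In a length metric, if `w` is closer to `z` than the frontier of an open neighbourhood `V` of
`z`, then the geodesics from `z` to `w` stay in `V`. -/
theorem IsGeodesic.mem_of_lt_frontier (hd : IsPlaneMetric d) (hl : IsLengthMetric d) {z w : ℂ}
    {V : Set ℂ} (hz : z ∈ V) {q : ℝ} (hw : d z w < q) (hV : ∀ x ∈ frontier V, q ≤ d z x)
    {p : ℝ → ℂ} {a b : ℝ} (hp : IsGeodesic d p a b z w) {t : ℝ} (ht : t ∈ Icc a b) : p t ∈ V := by
  by_contra hpt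
  obtain ⟨⟨hab, hcont, rfl, rfl⟩, hmin⟩ := hp
  obtain ⟨s, hs, hsV⟩ := exists_mem_frontier ht.1 (hcont.mono (Icc_subset_Icc_right ht.2)) hz hpt
  have hsb : s ≤ b := hs.2.trans ht.2
  have h1 : pathLength d p a b ≤ ENNReal.ofReal (d (p a) (p b)) := by
    rw [hl]
    exact le_iInf fun P' => le_iInf fun a' => le_iInf fun b' => le_iInf fun h =>
      hmin P' a' b' h.1
  -- The distance from `z` to the frontier point `p s` is at most the length of the geodesic up to
  -- `s`, hence at most `d z w`.
  have h2 := (dist_le_pathLength d p hs.1).trans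
    ((pathLength_mono_right d p hs.1 hsb).trans h1)
  rw [ENNReal.ofReal_le_ofReal_iff (hd.nonneg _ _), hd.symm] at h2
  linarith [hV _ hsV]

/-- The infimum of a plane metric over a set may be taken over a dense subset. -/
theorem IsPlaneMetric.le_of_dense (hd : IsPlaneMetric d) {z : ℂ} {q : ℝ} {S F : Set ℂ}
    (hF : F ⊆ closure S) (hS : ∀ x ∈ S, q ≤ d z x) : ∀ x ∈ F, q ≤ d z x := by
  intro x hx
  by_contra! hlt
  obtain ⟨y, hy, hyS⟩ := mem_closure_iff.1 (hF hx) _ (hd.isOpen_ball z q) hlt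
  exact absurd hy (not_lt.2 (hS y hyS))

/-! ### Weyl scaling -/

theorem IsPath.dist_le_of_unitSpeed {p : ℝ → ℂ} {L : ℝ}
    (hs : ∀ t ∈ Icc 0 L, pathLength d p 0 t = ENNReal.ofReal t) {s t : ℝ} (h0 : 0 ≤ s)
    (hst : s ≤ t) (htL : t ≤ L) : d (p t) (p s) ≤ t - s := by
  have h := pathLength_add_dist_le d p h0 hst
  rw [hs s ⟨h0, hst.trans htL⟩, hs t ⟨h0.trans hst, htL⟩] at h
  by_cases h1 : 0 ≤ d (p t) (p s)
  · rw [← ENNReal.ofReal_add h0 h1, ENNReal.ofReal_le_ofReal_iff (h0.trans hst)] at h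
    linarith
  · linarith

/-- If the Weyl scaling formula holds for the zero function, there are paths parametrized by
`d`-length which are almost of minimal length. -/
theorem exists_unitSpeed_path {ξ : ℝ} {x y : ℂ} {r : ℝ}
    (h : weylScale ξ 0 d x y < ENNReal.ofReal r) :
    ∃ (p : ℝ → ℂ) (L : ℝ), (IsPath p 0 L x y ∧ ∀ t ∈ Icc 0 L, pathLength d p 0 t = ENNReal.ofReal t)
      ∧ L < r := by
  simp only [weylScale, iInf_lt_iff] at h
  obtain ⟨p, L, hp, h⟩ := h
  refine ⟨p, L, hp, ?_⟩
  simp only [ContinuousMap.coe_zero, Pi.zero_apply, mul_zero, Real.exp_zero, ENNReal.ofReal_one,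
    lintegral_const, one_mul, Measure.restrict_apply MeasurableSet.univ, univ_inter,
    Real.volume_Icc, sub_zero] at h
  exact (ENNReal.ofReal_lt_ofReal_iff'.1 h).1

/-- An almost minimal unit-speed path from `x` has length less than `r`, so it never leaves the
`d`-ball of radius `r` about `x`, where the density is at most `e^m`. -/
theorem weylScale_le_of_le_on_ball {ξ : ℝ} {f : C(ℂ, ℝ)} {x y : ℂ} {r m : ℝ} (hd : IsPlaneMetric d)
    (h : weylScale ξ 0 d x y < ENNReal.ofReal r)
    (hf : ∀ u, d x u < r → ξ * f u ≤ m) : weylScale ξ f d x y ≤ ENNReal.ofReal (Real.exp m * r) := by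
  obtain ⟨p, L, hp, hL⟩ := exists_unitSpeed_path h
  calc weylScale ξ f d x y
      ≤ ∫⁻ t in Icc 0 L, ENNReal.ofReal (Real.exp (ξ * f (p t))) :=
        iInf_le_of_le p (iInf_le_of_le L (iInf_le_of_le hp le_rfl))
    _ ≤ ∫⁻ t in Icc 0 L, ENNReal.ofReal (Real.exp m) := by
        refine setLIntegral_mono measurable_const fun t ht => ENNReal.ofReal_le_ofReal
          (Real.exp_le_exp.2 (hf _ ?_))
        have h1 := IsPath.dist_le_of_unitSpeed hp.2 le_rfl ht.1 ht.2
        rw [hp.1.2.2.1, hd.symm] at h1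
        linarith [ht.2]
    _ = ENNReal.ofReal (Real.exp m * L) := by
        simp [ENNReal.ofReal_mul (Real.exp_pos m).le]
    _ ≤ _ := by gcongr

/-- The final stretch of length `c` of any unit-speed path ending at `x` stays in the `d`-ball of
radius `c` about `x`, where the density is at least `e^m`. -/
theorem le_weylScale_of_le_on_ball {ξ : ℝ} {f : C(ℂ, ℝ)} {z x : ℂ} {c m : ℝ}
    (hc : c ≤ d x z) (hf : ∀ u, d x u < c → m ≤ ξ * f u) :
    ENNReal.ofReal (Real.exp m * c) ≤ weylScale ξ f d z x := by
  refine le_iInf fun p => le_iInf fun L => le_iInf fun hp => ?_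
  have hcL : c ≤ L := by
    have h1 := IsPath.dist_le_of_unitSpeed hp.2 le_rfl hp.1.1 le_rfl
    rw [hp.1.2.2.1, hp.1.2.2.2] at h1
    linarith
  calc ENNReal.ofReal (Real.exp m * c) = ∫⁻ t in Ioc (L - c) L, ENNReal.ofReal (Real.exp m) := by
        simp [ENNReal.ofReal_mul (Real.exp_pos m).le]
    _ ≤ ∫⁻ t in Ioc (L - c) L, ENNReal.ofReal (Real.exp (ξ * f (p t))) := by
        refine setLIntegral_mono' measurableSet_Ioc fun t ht => ENNReal.ofReal_le_ofReal
          (Real.exp_le_exp.2 (hf _ ?_))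
        have h1 := IsPath.dist_le_of_unitSpeed hp.2 (by linarith [ht.1]) ht.2 le_rfl
        rw [hp.1.2.2.2] at h1
        linarith [ht.1]
    _ ≤ _ := lintegral_mono_set (Ioc_subset_Icc_self.trans (Icc_subset_Icc_left (by linarith)))

/-- Weyl scaling by large multiples of a function `g` that attains its largest value outside a
compact set in `V`, and is smaller on a connected set containing `z` and `w`, makes `w`
closer to `z` than the frontier of `V`. -/
theorem eventually_lt_frontier {D : ℕ → ℂ → ℂ → ℝ} {ξ : ℝ} (hξ : 0 < ξ) (hd : IsPlaneMetric d)
    (hD : ∀ n, IsPlaneMetric (D n)) {g : C(ℂ, ℝ)}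
    (h0 : ∀ x y, weylScale ξ 0 d x y = ENNReal.ofReal (d x y))
    (hg : ∀ (n : ℕ) x y, weylScale ξ ((n : ℝ) • g) d x y = ENNReal.ofReal (D n x y))
    {c₀ : ℝ} {K C V : Set ℂ} (hK : IsPreconnected K) (hgK : ∀ x ∈ K, g x < c₀) (hC : IsClosed C)
    (hgC : ∀ x ∉ C, g x = c₀) (hV : IsCompact (frontier V)) (hVC : Disjoint (frontier V) C)
    {z w : ℂ} (hz : z ∈ K) (hw : w ∈ K) :
    ∀ᶠ n in atTop, ∃ q : ℚ, D n z w < q ∧ ∀ x ∈ frontier V, (q : ℝ) ≤ D n z x := by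
  -- Near `x` one has `g < m < c₀`, so the distance from `x` to `y` is at most `e^{ξ n m} r`,
  -- negligible against `e^{ξ n c₀}`.
  have hloc : ∀ x ∈ K, ∀ᶠ y in 𝓝[K] x,
      Tendsto (fun n : ℕ => Real.exp (-(ξ * n * c₀)) * D n x y) atTop (𝓝 0) := by
    intro x hx
    obtain ⟨m, hm, hmc⟩ := exists_between (hgK x hx)
    obtain ⟨r, hr, hrx⟩ := (hd.isOpen_iff {u | g u < m}).1
      (isOpen_lt g.continuous continuous_const) x hm
    filter_upwards [mem_nhdsWithin_of_mem_nhds (hd.ball_mem_nhds x hr)] with y hy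
    have hlim : Tendsto (fun n : ℕ => Real.exp (-(ξ * (c₀ - m) * n)) * r) atTop (𝓝 0) := by
      rw [← zero_mul r]
      refine Tendsto.mul_const _ (Real.tendsto_exp_atBot.comp ?_)
      refine tendsto_neg_atTop_atBot.comp ?_
      exact tendsto_natCast_atTop_atTop.const_mul_atTop (mul_pos hξ (sub_pos.2 hmc))
    refine squeeze_zero (fun n => mul_nonneg (Real.exp_pos _).le ((hD n).nonneg _ _))
      (fun n => ?_) hlim
    have h1 : weylScale ξ ((n : ℝ) • g) d x y ≤ ENNReal.ofReal (Real.exp (ξ * n * m) * r) := by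
      refine weylScale_le_of_le_on_ball hd ?_ fun u hu => ?_
      · rw [h0]
        exact (ENNReal.ofReal_lt_ofReal_iff hr).2 hy
      · rw [ContinuousMap.smul_apply, smul_eq_mul, mul_assoc]
        have : g u ≤ m := le_of_lt (hrx u hu)
        gcongr
    rw [hg, ENNReal.ofReal_le_ofReal_iff (by positivity)] at h1
    calc Real.exp (-(ξ * n * c₀)) * D n x y
        ≤ Real.exp (-(ξ * n * c₀)) * (Real.exp (ξ * n * m) * r) := by gcongr
      _ = _ := by
        rw [← mul_assoc, ← Real.exp_add]
        ring_nf
  -- Vanishing of the rescaled distance is local, symmetric and transitive, so it spreads over the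
  -- connected set `K`.
  have hzw := hK.induction₂ _ hloc
    (fun x y z _ _ _ hxy hyz => by
      refine squeeze_zero (fun n => mul_nonneg (Real.exp_pos _).le ((hD n).nonneg _ _))
        (fun n => ?_) (by simpa using hxy.add hyz)
      rw [← mul_add]
      exact mul_le_mul_of_nonneg_left ((hD n).triangle x y z) (Real.exp_pos _).le)
    (fun x y _ _ hxy => by simpa only [(hD _).symm y x] using hxy) hz hw
  obtain ⟨c, hc, hcV⟩ := hd.exists_pos_le hV hC hVC
  have hzC : z ∈ C := by
    by_contra h
    exact (hgK z hz).ne (hgC z h)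
  filter_upwards [hzw.eventually (gt_mem_nhds hc)] with n hn
  have hlt : D n z w < Real.exp (ξ * n * c₀) * c := by
    rwa [Real.exp_neg, inv_mul_lt_iff₀ (Real.exp_pos _)] at hn
  obtain ⟨q, hq1, hq2⟩ := exists_rat_btwn hlt
  refine ⟨q, hq1, fun x hx => hq2.le.trans ?_⟩
  -- The `d`-ball of radius `c` about a frontier point misses `C`, so `g = c₀` on it.
  have h1 : ENNReal.ofReal (Real.exp (ξ * n * c₀) * c) ≤ weylScale ξ ((n : ℝ) • g) d z x := by
    refine le_weylScale_of_le_on_ball (hcV x hx z hzC) fun u hu => ?_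
    have hu' : u ∉ C := fun h => (hcV x hx u h).not_gt hu
    rw [ContinuousMap.smul_apply, smul_eq_mul, mul_assoc, hgC u hu']
  rwa [hg, ENNReal.ofReal_le_ofReal_iff ((hD n).nonneg _ _)] at h1

end Metric
/-! ### Absolute continuity of the free field under Cameron-Martin shifts -/

section CameronMartin

/-- Random distributions can thus be treated as processes indexed by test functions, which is where
independence of Gaussian processes is available. -/
theorem measurableSpace_planeDistribution_eq_comap :
    (instMeasurableSpaceDistribution ⊤ : MeasurableSpace PlaneDistribution)
      = MeasurableSpace.comap (fun (T : PlaneDistribution) (φ : PlaneTest) => T φ)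
          MeasurableSpace.pi := by
  simp only [instMeasurableSpaceDistribution, MeasurableSpace.pi, MeasurableSpace.comap_iSup,
    MeasurableSpace.comap_comp, ← BorelSpace.measurable_eq (α := ℝ)]
  rfl

theorem measurable_planeDistribution_iff {α : Type*} [MeasurableSpace α]
    {f : α → PlaneDistribution} : Measurable f ↔ ∀ φ : PlaneTest, Measurable fun x => f x φ := by
  rw [← measurable_pi_iff, measurableSpace_planeDistribution_eq_comap, measurable_comap_iff]
  rfl

theorem measurable_eval_planeDistribution (φ : PlaneTest) :
    Measurable fun T : PlaneDistribution => T φ :=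
  measurable_planeDistribution_iff.1 measurable_id φ

theorem measurable_add_smul (G : PlaneDistribution) :
    Measurable fun x : PlaneDistribution × ℝ => x.1 + x.2 • G := by
  refine measurable_planeDistribution_iff.2 fun φ => ?_
  show Measurable fun x : PlaneDistribution × ℝ => x.1 φ + x.2 * G φ
  exact ((measurable_eval_planeDistribution φ).comp measurable_fst).add
    (measurable_snd.mul_const _)

variable {Ω : Type*} [MeasurableSpace Ω] {P : Measure Ω} [IsProbabilityMeasure P]
  {h : Ω → PlaneDistribution}

/-- Gaussian regression: subtracting the projection onto `(h, ψ)` leaves a field jointly Gaussian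
with `(h, ψ)` and uncorrelated with it, hence independent. -/
theorem IsWholePlaneGFF.indepFun_sub_smul (hh : IsWholePlaneGFF h P) {ψ : PlaneTest}
    {G : PlaneDistribution} (hG : ∀ φ : PlaneTest, cov[fun ω => h ω φ, fun ω => h ω ψ; P] = G φ)
    (hψ : Var[fun ω => h ω ψ; P] ≠ 0) :
    IndepFun (fun ω => h ω - (h ω ψ / Var[fun ω => h ω ψ; P]) • G) (fun ω => h ω ψ) P := by
  set v := Var[fun ω => h ω ψ; P] with hv
  have hmem : ∀ φ : PlaneTest, MemLp (fun ω => h ω φ) 2 P := fun φ =>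
    (hh.gaussian.hasGaussianLaw_eval φ).memLp_two
  have hX : Measurable fun ω => h ω - (h ω ψ / v) • G := by
    refine measurable_planeDistribution_iff.2 fun φ => ?_
    show Measurable fun ω => h ω φ - h ω ψ / v * G φ
    have h1 := measurable_planeDistribution_iff.1 hh.measurable
    exact (h1 φ).sub (((h1 ψ).div_const v).mul_const _)
  have key : IndepFun (fun ω (φ : PlaneTest) => (h ω - (h ω ψ / v) • G) φ)
      (fun ω (_ : Unit) => h ω ψ) P := by
    refine IsGaussianProcess.indepFun_of_covariance_eq_zero
      (X := fun φ ω => (h ω - (h ω ψ / v) • G) φ) (Y := fun _ ω => h ω ψ) ?_ ?_ ?_ ?_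
    · classical
      refine hh.gaussian.of_isGaussianProcess fun s => ?_
      rcases s with φ | _
      · refine ⟨{φ, ψ}, ContinuousLinearMap.proj ⟨φ, by simp⟩ -
          (G φ / v) • ContinuousLinearMap.proj ⟨ψ, by simp⟩, fun ω => ?_⟩
        show h ω φ - h ω ψ / v * G φ = h ω φ - G φ / v * h ω ψ
        ring
      · exact ⟨{ψ}, ContinuousLinearMap.proj ⟨ψ, by simp⟩, fun ω => rfl⟩
    · exact fun φ => (measurable_planeDistribution_iff.1 hX φ).aemeasurable
    · exact fun _ => (measurable_planeDistribution_iff.1 hh.measurable ψ).aemeasurable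
    · intro φ _
      have : (fun ω => (h ω - (h ω ψ / v) • G) φ) = (fun ω => h ω φ) - fun ω => G φ / v * h ω ψ := by
        ext ω
        show h ω φ - h ω ψ / v * G φ = h ω φ - G φ / v * h ω ψ
        ring
      rw [this, covariance_sub_left (hmem φ) ((hmem ψ).const_mul _) (hmem ψ), hG,
        covariance_const_mul_left, covariance_self, ← hv]
      · field_simp
        ring
      · exact (hmem ψ).aemeasurable
  have hm : Measurable fun f : Unit → ℝ => f () := measurable_pi_apply ()
  have key' := key.comp measurable_id hm
  rw [IndepFun_iff_Indep] at key' ⊢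
  rwa [measurableSpace_planeDistribution_eq_comap, MeasurableSpace.comap_comp]

/-- Write `h = X + ((h, ψ) / v) G` with `X` independent of `(h, ψ)`. Adding `t G` only translates
the real Gaussian coefficient of `G`, and nondegenerate Gaussian laws on the line are mutually
absolutely continuous. -/
theorem IsWholePlaneGFF.map_add_absolutelyContinuous (hh : IsWholePlaneGFF h P) {ψ : PlaneTest}
    {G : PlaneDistribution} (hG : ∀ φ : PlaneTest, cov[fun ω => h ω φ, fun ω => h ω ψ; P] = G φ)
    (t : ℝ) : P.map (fun ω => h ω + t • G) ≪ P.map h := by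
  set v := Var[fun ω => h ω ψ; P] with hv
  have hmem : ∀ φ : PlaneTest, MemLp (fun ω => h ω φ) 2 P := fun φ =>
    (hh.gaussian.hasGaussianLaw_eval φ).memLp_two
  have hψm : Measurable fun ω => h ω ψ := measurable_planeDistribution_iff.1 hh.measurable ψ
  by_cases hv0 : v = 0
  -- With zero variance `(h, ψ)` is almost surely constant, so all its covariances vanish and there
  -- is no shift.
  · have hG0 : G = 0 := by
      ext φ
      rw [← hG, covariance]
      refine integral_eq_zero_of_ae ?_
      filter_upwards [ae_eq_integral_of_variance_eq_zero (hmem ψ) hv0] with ω hω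
      simp [hω]
    simp [hG0, Measure.AbsolutelyContinuous.rfl]
  · have hind := hh.indepFun_sub_smul hG hv0
    rw [← hv] at hind
    set X : Ω → PlaneDistribution := fun ω => h ω - (h ω ψ / v) • G with hX
    have hXm : Measurable X := by
      have := (measurable_add_smul G).comp (hh.measurable.prodMk (hψm.div_const v).neg)
      convert this using 2 with ω
      ext φ
      simp [hX, sub_eq_add_neg]
    have hYm : Measurable fun ω => h ω ψ / v := hψm.div_const v
    have hind0 : IndepFun X (fun ω => h ω ψ / v) P :=
      hind.comp measurable_id (measurable_id.div_const v)
    have hind1 : IndepFun X (fun ω => h ω ψ / v + t) P :=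
      hind.comp measurable_id ((measurable_id.div_const v).add_const t)
    have h0 : h = (fun x : PlaneDistribution × ℝ => x.1 + x.2 • G) ∘
        fun ω => (X ω, h ω ψ / v) := by
      ext1 ω
      simp [hX]
    have h1 : (fun ω => h ω + t • G) = (fun x : PlaneDistribution × ℝ => x.1 + x.2 • G) ∘
        fun ω => (X ω, h ω ψ / v + t) := by
      ext1 ω
      simp [hX, add_smul, ← add_assoc]
    obtain ⟨m, v', hv', hlaw⟩ : ∃ (m : ℝ) (v' : NNReal), v' ≠ 0 ∧
        P.map (fun ω => h ω ψ / v) = gaussianReal m v' := by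
      have h2 := (hh.gaussian.hasGaussianLaw_eval ψ).map_eq_gaussianReal
      have h3 := Measure.map_map (μ := P) (measurable_id.div_const v) hψm
      rw [h2] at h3
      refine ⟨_, _, ?_, h3.symm.trans (gaussianReal_map_div_const v)⟩
      refine div_ne_zero (Real.toNNReal_pos.2 ?_).ne' ?_
      · exact lt_of_le_of_ne (variance_nonneg _ _) (Ne.symm hv0)
      · simpa [← NNReal.coe_inj] using hv0
    have hac : P.map (fun ω => h ω ψ / v + t) ≪ P.map (fun ω => h ω ψ / v) := by
      have h2 := Measure.map_map (μ := P) (measurable_id.add_const t) hYm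
      have h3 : P.map (fun ω => h ω ψ / v + t) = gaussianReal (m + t) v' := by
        rw [hlaw] at h2
        exact h2.symm.trans (gaussianReal_map_add_const t)
      rw [h3, hlaw]
      exact (gaussianReal_absolutelyContinuous _ hv').trans
        (gaussianReal_absolutelyContinuous' _ hv')
    rw [h1, ← Measure.map_map (measurable_add_smul G) (hXm.prodMk (hYm.add_const t)),
      (indepFun_iff_map_prod_eq_prod_map_map hXm.aemeasurable (hYm.add_const t).aemeasurable).1
        hind1]
    conv_rhs => rw [h0, ← Measure.map_map (measurable_add_smul G) (hXm.prodMk hYm),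
      (indepFun_iff_map_prod_eq_prod_map_map hXm.aemeasurable hYm.aemeasurable).1 hind0]
    exact (Measure.AbsolutelyContinuous.rfl.prod hac).map (measurable_add_smul G)

end CameronMartin
/-! ### Logarithmic potentials -/

section Potential

theorem locallyIntegrable_log_norm : LocallyIntegrable fun z : ℂ => Real.log ‖z‖ := by
  refine locallyIntegrable_iff.2 fun k hk => ?_
  obtain ⟨r, hr⟩ := hk.isBounded.subset_ball 0
  refine IntegrableOn.mono_set ?_ hr
  refine (integrableOn_fun_norm_addHaar volume).2 ?_
  simp only [Complex.finrank_real_complex, Nat.add_one_sub_one, pow_one, smul_eq_mul]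
  exact (Real.continuous_mul_log.integrableOn_Icc (a := 0) (b := r)).mono_set Ioo_subset_Icc_self

theorem integrable_mul_log_norm_sub {ψ : ℂ → ℝ} (hψ : Continuous ψ) (hs : HasCompactSupport ψ)
    (z : ℂ) : Integrable fun w => ψ w * Real.log ‖z - w‖ :=
  hs.convolutionExists_left (ContinuousLinearMap.mul ℝ ℝ) hψ locallyIntegrable_log_norm z

theorem continuous_integral_mul_log_norm_sub {ψ : ℂ → ℝ} (hψ : Continuous ψ)
    (hs : HasCompactSupport ψ) : Continuous fun z => ∫ w, ψ w * Real.log ‖z - w‖ :=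
  hs.continuous_convolution_left (ContinuousLinearMap.mul ℝ ℝ) hψ locallyIntegrable_log_norm

theorem integrable_mul_mul_log_norm_sub {φ ψ : ℂ → ℝ} (hφ : Continuous φ)
    (hφs : HasCompactSupport φ) (hψ : Continuous ψ) (hψs : HasCompactSupport ψ) :
    Integrable fun p : ℂ × ℂ => φ p.1 * (ψ p.2 * Real.log ‖p.1 - p.2‖) := by
  obtain ⟨r, hr⟩ := hφs.isCompact.isBounded.subset_closedBall 0
  obtain ⟨s, hs⟩ := hψs.isCompact.isBounded.subset_closedBall 0
  obtain ⟨C, hC⟩ := hφ.bounded_above_of_compact_support hφs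
  -- On the support of `φ ⊗ ψ` the difference of the two points has norm at most `r + s`; truncating
  -- the logarithm there changes nothing and makes it integrable.
  have h1 : Integrable ((Metric.closedBall (0 : ℂ) (r + s)).indicator fun z => Real.log ‖z‖) :=
    (integrable_indicator_iff measurableSet_closedBall).2
      (locallyIntegrable_iff.1 locallyIntegrable_log_norm _ (isCompact_closedBall _ _))
  have h2 := (hψ.integrable_of_hasCompactSupport hψs (μ := volume)).convolution_integrand
    (ContinuousLinearMap.mul ℝ ℝ) h1
  have h3 := h2.bdd_mul (f := fun p : ℂ × ℂ => φ p.1) (c := C)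
    (hφ.comp continuous_fst).aestronglyMeasurable (ae_of_all _ fun p => hC p.1)
  refine h3.congr (ae_of_all _ fun p => ?_)
  show φ p.1 * (ψ p.2 * _) = _
  by_cases h1 : φ p.1 = 0
  · simp [h1]
  by_cases h2 : ψ p.2 = 0
  · simp [h2]
  rw [indicator_of_mem]
  have h3 := hr (subset_tsupport _ h1)
  have h4 := hs (subset_tsupport _ h2)
  rw [mem_closedBall_zero_iff] at h3 h4 ⊢
  exact (norm_sub_le _ _).trans (add_le_add h3 h4)

theorem continuous_log_max_norm : Continuous fun z : ℂ => Real.log (max ‖z‖ 1) :=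
  (continuous_norm.max continuous_const).log fun _ => (lt_max_of_lt_right one_pos).ne'

theorem greenKernel_eq {z w : ℂ} (h : z ≠ w) :
    greenKernel z w = Real.log (max ‖z‖ 1) + Real.log (max ‖w‖ 1) - Real.log ‖z - w‖ := by
  have h1 : ∀ u : ℂ, max ‖u‖ 1 ≠ 0 := fun u => (lt_max_of_lt_right one_pos).ne'
  rw [greenKernel, Real.log_div (mul_ne_zero (h1 z) (h1 w)) (norm_ne_zero_iff.2 (sub_ne_zero.2 h)),
    Real.log_mul (h1 z) (h1 w)]

theorem ae_fst_ne_snd : ∀ᵐ p : ℂ × ℂ, p.1 ≠ p.2 := by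
  have hm : MeasurableSet {p : ℂ × ℂ | p.1 = p.2} := measurableSet_eq_fun measurable_fst measurable_snd
  rw [ae_iff]
  simp only [ne_eq, not_not]
  refine (Measure.measure_prod_null hm).2 (ae_of_all _ fun z => ?_)
  have : Prod.mk z ⁻¹' {p : ℂ × ℂ | p.1 = p.2} = {z} := by
    ext w
    simp [eq_comm]
  simp [this]

/-- The Green potential of a function of mean zero is, up to an additive constant, its logarithmic
potential. -/
theorem integral_mul_mul_greenKernel {φ ψ : ℂ → ℝ} (hφ : Continuous φ)
    (hφs : HasCompactSupport φ) (hψ : Continuous ψ) (hψs : HasCompactSupport ψ)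
    (hψ0 : ∫ w, ψ w = 0) :
    ∫ p : ℂ × ℂ, φ p.1 * ψ p.2 * greenKernel p.1 p.2
      = ∫ z, φ z * ((∫ w, ψ w * Real.log (max ‖w‖ 1)) - ∫ w, ψ w * Real.log ‖z - w‖) := by
  have hl := continuous_log_max_norm
  have h1 : Integrable fun p : ℂ × ℂ => φ p.1 * Real.log (max ‖p.1‖ 1) * ψ p.2 :=
    ((hφ.mul hl).integrable_of_hasCompactSupport hφs.mul_right).mul_prod
      (hψ.integrable_of_hasCompactSupport hψs)
  have h2 : Integrable fun p : ℂ × ℂ => φ p.1 * (ψ p.2 * Real.log (max ‖p.2‖ 1)) :=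
    (hφ.integrable_of_hasCompactSupport hφs).mul_prod
      ((hψ.mul hl).integrable_of_hasCompactSupport hψs.mul_right)
  have h3 := integrable_mul_mul_log_norm_sub hφ hφs hψ hψs
  calc ∫ p : ℂ × ℂ, φ p.1 * ψ p.2 * greenKernel p.1 p.2
      = ∫ p : ℂ × ℂ, φ p.1 * Real.log (max ‖p.1‖ 1) * ψ p.2
          + φ p.1 * (ψ p.2 * Real.log (max ‖p.2‖ 1)) - φ p.1 * (ψ p.2 * Real.log ‖p.1 - p.2‖) := by
        refine integral_congr_ae ?_
        filter_upwards [ae_fst_ne_snd] with p hp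
        rw [greenKernel_eq hp]
        ring
    _ = ∫ z, ∫ w, φ z * Real.log (max ‖z‖ 1) * ψ w
          + φ z * (ψ w * Real.log (max ‖w‖ 1)) - φ z * (ψ w * Real.log ‖z - w‖) :=
        integral_prod _ ((h1.add h2).sub h3)
    _ = _ := by
        refine integral_congr_ae (ae_of_all _ fun z => ?_)
        have h4 : Integrable fun w => φ z * Real.log (max ‖z‖ 1) * ψ w :=
          (hψ.integrable_of_hasCompactSupport hψs).const_mul _
        have h5 : Integrable fun w => φ z * (ψ w * Real.log (max ‖w‖ 1)) :=
          ((hψ.mul hl).integrable_of_hasCompactSupport hψs.mul_right).const_mul _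
        have h6 := (integrable_mul_log_norm_sub hψ hψs z).const_mul (φ z)
        dsimp only
        have h45 : Integrable fun w => φ z * Real.log (max ‖z‖ 1) * ψ w
            + φ z * (ψ w * Real.log (max ‖w‖ 1)) := h4.add h5
        rw [integral_sub h45 h6, integral_add h4 h5, integral_const_mul, integral_const_mul,
          integral_const_mul, hψ0]
        ring

/-- In an integral against a radial function one may replace the other factor by its averages over
circles. -/
theorem integral_radial_mul {κ : ℝ → ℝ} {f : ℂ → ℝ} (hκ : Measurable κ) (hf : Measurable f)
    (hint : Integrable fun v : ℂ => κ ‖v‖ * f v) :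
    ∫ v : ℂ, κ ‖v‖ * f v = ∫ v : ℂ, κ ‖v‖ * Real.circleAverage f 0 ‖v‖ := by
  -- Rotations preserve the integral and the radial factor; averaging over the angle and exchanging
  -- integrals produces the circle averages.
  let e : ℝ → ℂ → ℂ := fun θ v => circleMap 0 1 θ * v
  have hen : ∀ θ v, ‖e θ v‖ = ‖v‖ := fun θ v => by simp [e]
  have hrot : ∀ θ, MeasurePreserving (e θ) ∧ MeasurableEmbedding (e θ) := fun θ => by
    have h := (rotation (Circle.exp θ)).measurePreserving
    have h2 : e θ = rotation (Circle.exp θ) := by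
      ext v
      simp [e, circleMap, rotation_apply]
    rw [h2]
    exact ⟨h, (rotation (Circle.exp θ)).toHomeomorph.measurableEmbedding⟩
  have h1 : ∀ (F : ℂ → ℝ) θ, ∫ v, F (e θ v) = ∫ v, F v := fun F θ =>
    (hrot θ).1.integral_comp (hrot θ).2 F
  have hem : Measurable fun p : ℝ × ℂ => e p.1 p.2 := by
    have : Continuous fun p : ℝ × ℂ => e p.1 p.2 := by
      simp only [e]
      fun_prop
    exact this.measurable
  have hK : Integrable (Function.uncurry fun θ v => κ ‖v‖ * f (e θ v))
      ((volume.restrict (Ioc 0 (2 * Real.pi))).prod volume) := by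
    have hm : Measurable (Function.uncurry fun θ v => κ ‖v‖ * f (e θ v)) :=
      (hκ.comp measurable_snd.norm).mul (hf.comp hem)
    refine (integrable_prod_iff hm.aestronglyMeasurable).2 ⟨ae_of_all _ fun θ => ?_, ?_⟩
    · have := ((hrot θ).1.integrable_comp_emb (hrot θ).2).2 hint
      refine this.congr (ae_of_all _ fun v => ?_)
      simp [hen]
    · have : ∀ θ, ∫ v, ‖Function.uncurry (fun θ v => κ ‖v‖ * f (e θ v)) (θ, v)‖
          = ∫ v, ‖κ ‖v‖ * f v‖ := fun θ => by
        rw [← h1 (fun v => ‖κ ‖v‖ * f v‖) θ]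
        simp [hen]
      simp only [this]
      exact integrable_const _
  have h2 := integral_integral_swap hK
  have h3 : ∀ θ, ∫ v, κ ‖v‖ * f (e θ v) = ∫ v, κ ‖v‖ * f v := fun θ => by
    rw [← h1 (fun v => κ ‖v‖ * f v) θ]
    simp [hen]
  have h4 : ∀ v : ℂ, ∫ θ in Ioc 0 (2 * Real.pi), κ ‖v‖ * f (e θ v)
      = 2 * Real.pi * (κ ‖v‖ * Real.circleAverage f 0 ‖v‖) := fun v => by
    rw [integral_const_mul, Real.circleAverage_eq_integral_add v.arg,
      intervalIntegral.integral_of_le Real.two_pi_pos.le]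
    have : ∀ θ, e θ v = circleMap 0 ‖v‖ (θ + v.arg) := fun θ => by
      simp only [e, circleMap, zero_add, Complex.ofReal_one, one_mul, Complex.ofReal_add, add_mul,
        Complex.exp_add]
      rw [mul_left_comm, Complex.norm_mul_exp_arg_mul_I]
    simp only [this, smul_eq_mul]
    have := Real.pi_ne_zero
    field_simp
  simp only [h3, h4, integral_const_mul] at h2
  rw [integral_const, measureReal_restrict_apply MeasurableSet.univ, univ_inter, smul_eq_mul,
    measureReal_def, Real.volume_Ioc, sub_zero, ENNReal.toReal_ofReal Real.two_pi_pos.le] at h2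
  exact mul_left_cancel₀ Real.two_pi_pos.ne' h2

/-! ### Compactly supported logarithmic potentials -/

/-- A smooth bump on the half-line, supported in `[0, r]`. -/
noncomputable def radialProfile (r s : ℝ) : ℝ := Real.smoothTransition (1 - s ^ 2 / r ^ 2)

theorem radialProfile_nonneg (r s : ℝ) : 0 ≤ radialProfile r s := Real.smoothTransition.nonneg _

theorem radialProfile_eq_zero {r s : ℝ} (hr : 0 < r) (hs : r ≤ s) : radialProfile r s = 0 := by
  refine Real.smoothTransition.zero_of_nonpos (sub_nonpos.2 ?_)
  rw [one_le_div (by positivity)]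
  gcongr

theorem continuous_radialProfile (r : ℝ) : Continuous (radialProfile r) :=
  Real.smoothTransition.continuous.comp (by fun_prop)

theorem contDiff_radialProfile_norm (r : ℝ) :
    ContDiff ℝ ((⊤ : ℕ∞) : WithTop ℕ∞) fun v : ℂ => radialProfile r ‖v‖ := by
  have h1 : ContDiff ℝ ((⊤ : ℕ∞) : WithTop ℕ∞) fun v : ℂ => ‖v‖ ^ 2 := contDiff_id.norm_sq ℝ
  exact Real.smoothTransition.contDiff.comp (contDiff_const.sub (h1.div_const _))

theorem hasCompactSupport_radialProfile_norm {r : ℝ} (hr : 0 < r) :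
    HasCompactSupport fun v : ℂ => radialProfile r ‖v‖ :=
  HasCompactSupport.intro (isCompact_closedBall 0 r) fun v hv =>
    radialProfile_eq_zero hr (by simpa using (not_le.1 (mt mem_closedBall_zero_iff.2 hv)).le)

theorem integral_radialProfile_norm_pos {r : ℝ} (hr : 0 < r) :
    0 < ∫ v : ℂ, radialProfile r ‖v‖ :=
  ((continuous_radialProfile r).comp continuous_norm).integral_pos_of_hasCompactSupport_nonneg_nonzero
    (hasCompactSupport_radialProfile_norm hr) (fun v => radialProfile_nonneg r _)
    (x := 0) (by simp [radialProfile])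

/-- A radial function about `a` of mean zero: a smooth probability density spread over the disk of
radius `2 r` minus its copy spread over the disk of radius `r`, up to a factor. -/
noncomputable def bumpSource (a : ℂ) (r : ℝ) (w : ℂ) : ℝ :=
  (1 / 4) * radialProfile r ‖(2 : ℝ)⁻¹ • (w - a)‖ - radialProfile r ‖w - a‖

theorem contDiff_bumpSource (a : ℂ) (r : ℝ) :
    ContDiff ℝ ((⊤ : ℕ∞) : WithTop ℕ∞) (bumpSource a r) := by
  have h := contDiff_radialProfile_norm r
  have h1 : ContDiff ℝ ((⊤ : ℕ∞) : WithTop ℕ∞) fun w : ℂ => w - a :=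
    contDiff_id.sub contDiff_const
  have h2 : ContDiff ℝ ((⊤ : ℕ∞) : WithTop ℕ∞) fun w : ℂ => (2 : ℝ)⁻¹ • (w - a) :=
    h1.const_smul _
  have h3 : ContDiff ℝ ((⊤ : ℕ∞) : WithTop ℕ∞)
      fun w : ℂ => radialProfile r ‖(2 : ℝ)⁻¹ • (w - a)‖ :=
    ContDiff.comp (g := fun v : ℂ => radialProfile r ‖v‖) h h2
  have h4 : ContDiff ℝ ((⊤ : ℕ∞) : WithTop ℕ∞) fun w : ℂ => radialProfile r ‖w - a‖ :=
    ContDiff.comp (g := fun v : ℂ => radialProfile r ‖v‖) h h1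
  exact (h3.const_smul (1 / 4 : ℝ)).sub h4

theorem hasCompactSupport_bumpSource (a : ℂ) {r : ℝ} (hr : 0 < r) :
    HasCompactSupport (bumpSource a r) := by
  refine HasCompactSupport.intro (isCompact_closedBall a (2 * r)) fun w hw => ?_
  have h1 : 2 * r < ‖w - a‖ := by simpa [dist_eq_norm] using hw
  have h2 : ‖(2 : ℝ)⁻¹ • (w - a)‖ = 2⁻¹ * ‖w - a‖ := by simp
  rw [bumpSource, h2, radialProfile_eq_zero hr (by linarith), radialProfile_eq_zero hr (by linarith)]
  simp

theorem integral_comp_half_sub (F : ℂ → ℝ) (a : ℂ) :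
    ∫ w, F ((2 : ℝ)⁻¹ • (w - a)) = 4 * ∫ v, F v := by
  rw [integral_sub_right_eq_self (fun w => F ((2 : ℝ)⁻¹ • w)) a, Measure.integral_comp_smul]
  simp
  norm_num

theorem integrable_radialProfile_mul_log {r t : ℝ} (hr : 0 < r) (ht : t ≠ 0) (z : ℂ) :
    Integrable fun v : ℂ => radialProfile r ‖v‖ * Real.log ‖z - t • v‖ := by
  have h : HasCompactSupport fun w : ℂ => radialProfile r ‖t⁻¹ • w‖ :=
    (hasCompactSupport_radialProfile_norm hr).comp_homeomorph
      (Homeomorph.smulOfNeZero t⁻¹ (inv_ne_zero ht))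
  have h1 := (integrable_mul_log_norm_sub (((continuous_radialProfile r).comp
    (continuous_norm.comp (continuous_const_smul t⁻¹)))) h z).comp_smul ht
  refine h1.congr (ae_of_all _ fun v => ?_)
  simp [ht]

/-- The logarithmic potential of `bumpSource`, a bump function supported in the disk of radius
`2 r` about `a`. -/
noncomputable def bump (a : ℂ) (r : ℝ) (z : ℂ) : ℝ := ∫ w, bumpSource a r w * Real.log ‖z - w‖

theorem integral_bumpSource (a : ℂ) {r : ℝ} (hr : 0 < r) : ∫ w, bumpSource a r w = 0 := by
  have hi := (contDiff_radialProfile_norm r).continuous.integrable_of_hasCompactSupport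
    (hasCompactSupport_radialProfile_norm hr) (μ := volume)
  have h1 : Integrable fun w : ℂ => (1 / 4) * radialProfile r ‖(2 : ℝ)⁻¹ • (w - a)‖ :=
    ((hi.comp_smul (by norm_num : (2 : ℝ)⁻¹ ≠ 0)).comp_sub_right a).const_mul _
  have h2 : Integrable fun w : ℂ => radialProfile r ‖w - a‖ := hi.comp_sub_right a
  simp only [bumpSource]
  rw [integral_sub h1 h2, integral_const_mul,
    integral_comp_half_sub (fun v => radialProfile r ‖v‖),
    integral_sub_right_eq_self (fun v : ℂ => radialProfile r ‖v‖)]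
  ring

/-- The substitutions `w = a + 2 v` and `w = a + v` bring both terms to the same profile; the factor
`1 / 4` cancels the planar Jacobian of the dilation. -/
theorem bump_eq_integral (a : ℂ) {r : ℝ} (hr : 0 < r) (z : ℂ) :
    bump a r z = ∫ v : ℂ, radialProfile r ‖v‖ *
      (Real.log ‖z - a - (2 : ℝ) • v‖ - Real.log ‖z - a - v‖) := by
  have h2 := integrable_radialProfile_mul_log hr two_ne_zero (z - a)
  have h1 : Integrable fun v : ℂ => radialProfile r ‖v‖ * Real.log ‖z - a - v‖ := by
    simpa using integrable_radialProfile_mul_log hr one_ne_zero (z - a)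
  have h3 : Integrable fun w : ℂ =>
      (1 / 4) * (radialProfile r ‖(2 : ℝ)⁻¹ • (w - a)‖
        * Real.log ‖z - a - (2 : ℝ) • (2 : ℝ)⁻¹ • (w - a)‖) :=
    ((h2.comp_smul (by norm_num : (2 : ℝ)⁻¹ ≠ 0)).comp_sub_right a).const_mul _
  have h4 := h1.comp_sub_right a
  have h5 := integral_comp_half_sub
    (fun v => radialProfile r ‖v‖ * Real.log ‖z - a - (2 : ℝ) • v‖) a
  have h6 := integral_sub_right_eq_self
    (fun v => radialProfile r ‖v‖ * Real.log ‖z - a - v‖) a (μ := volume)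
  calc bump a r z = ∫ w, ((1 / 4) * (radialProfile r ‖(2 : ℝ)⁻¹ • (w - a)‖
        * Real.log ‖z - a - (2 : ℝ) • (2 : ℝ)⁻¹ • (w - a)‖)
        - radialProfile r ‖w - a‖ * Real.log ‖z - a - (w - a)‖) := by
        refine integral_congr_ae (ae_of_all _ fun w => ?_)
        dsimp only
        rw [smul_inv_smul₀ two_ne_zero, sub_sub_sub_cancel_right, bumpSource]
        ring
    _ = _ := by
        simp only [mul_sub]
        rw [integral_sub h3 h4, integral_const_mul, h5, h6, integral_sub h2 h1]
        ring

theorem continuous_bump (a : ℂ) {r : ℝ} (hr : 0 < r) : Continuous (bump a r) :=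
  continuous_integral_mul_log_norm_sub (contDiff_bumpSource a r).continuous
    (hasCompactSupport_bumpSource a hr)

/-- Newton's theorem for the logarithm, an instance of Jensen's formula. -/
theorem circleAverage_log_norm_sub_smul (z : ℂ) {t R : ℝ} (ht : 0 < t) (hR : 0 < R) :
    Real.circleAverage (fun v => Real.log ‖z - t • v‖) 0 R = Real.log (max (t * R) ‖z‖) := by
  have h1 : Real.circleAverage (fun v => Real.log ‖z - t • v‖) 0 R
      = Real.circleAverage (fun v => Real.log ‖v - z‖) 0 (t * R) := by
    simp only [Real.circleAverage_def]
    congr 2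
    ext θ
    rw [norm_sub_rev]
    simp [circleMap, mul_assoc]
  have htR : 0 < t * R := mul_pos ht hR
  rw [h1, circleAverage_log_norm_sub_const_eq_log_radius_add_posLog htR.ne',
    Real.posLog_eq_log_max_one (by positivity), ← Real.log_mul htR.ne'
      (lt_max_of_lt_left one_pos).ne', mul_max_of_nonneg _ _ htR.le, mul_one, zero_sub, norm_neg,
    mul_inv_cancel_left₀ htR.ne']

/-- In this form the sign, the support and the value at the centre of the bump can be read off from
the integrand. -/
theorem bump_eq_integral_log_max (a : ℂ) {r : ℝ} (hr : 0 < r) (z : ℂ) :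
    bump a r z = ∫ v : ℂ, radialProfile r ‖v‖ *
      (Real.log (max (2 * ‖v‖) ‖z - a‖) - Real.log (max ‖v‖ ‖z - a‖)) := by
  have h1 : Integrable fun v : ℂ => radialProfile r ‖v‖ *
      (Real.log ‖z - a - (2 : ℝ) • v‖ - Real.log ‖z - a - v‖) := by
    simp only [mul_sub]
    have h := integrable_radialProfile_mul_log hr one_ne_zero (z - a)
    simp only [one_smul] at h
    exact (integrable_radialProfile_mul_log hr two_ne_zero (z - a)).sub h
  have hm : Measurable fun v : ℂ => Real.log ‖z - a - (2 : ℝ) • v‖ - Real.log ‖z - a - v‖ := by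
    fun_prop
  rw [bump_eq_integral a hr, integral_radial_mul (continuous_radialProfile r).measurable hm h1]
  refine integral_congr_ae ?_
  filter_upwards [compl_mem_ae_iff.2 (measure_singleton (0 : ℂ))] with v hv
  have hv : 0 < ‖v‖ := norm_pos_iff.2 hv
  have hci : ∀ t : ℝ, CircleIntegrable (fun v => Real.log ‖z - a - t • v‖) 0 ‖v‖ := fun t =>
    MeromorphicOn.circleIntegrable_log_norm fun _ _ => by
      simp only [Complex.real_smul]
      fun_prop
  have h2 := circleAverage_log_norm_sub_smul (z - a) two_pos hv
  have h3 := circleAverage_log_norm_sub_smul (z - a) one_pos hv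
  have h4 := hci 1
  simp only [one_smul, one_mul] at h3 h4
  rw [Real.circleAverage_fun_sub (hci 2) h4, h2, h3]

theorem bump_nonneg (a : ℂ) {r : ℝ} (hr : 0 < r) (z : ℂ) : 0 ≤ bump a r z := by
  rw [bump_eq_integral_log_max a hr]
  refine integral_nonneg_of_ae ?_
  filter_upwards [compl_mem_ae_iff.2 (measure_singleton (0 : ℂ))] with v hv
  have hv : 0 < ‖v‖ := norm_pos_iff.2 hv
  refine mul_nonneg (radialProfile_nonneg _ _) (sub_nonneg.2 (Real.log_le_log
    (lt_max_of_lt_left hv) (max_le_max_right _ (by linarith))))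

theorem bump_eq_zero {a : ℂ} {r : ℝ} (hr : 0 < r) {z : ℂ} (hz : 2 * r ≤ ‖z - a‖) :
    bump a r z = 0 := by
  rw [bump_eq_integral_log_max a hr]
  refine integral_eq_zero_of_ae (ae_of_all _ fun v => ?_)
  show _ * _ = (0 : ℝ)
  rcases le_total r ‖v‖ with hv | hv
  · rw [radialProfile_eq_zero hr hv, zero_mul]
  · rw [max_eq_right (by linarith), max_eq_right (by linarith), sub_self, mul_zero]

theorem bump_self_pos (a : ℂ) {r : ℝ} (hr : 0 < r) : 0 < bump a r a := by
  have h : bump a r a = (∫ v : ℂ, radialProfile r ‖v‖) * Real.log 2 := by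
    rw [bump_eq_integral_log_max a hr, ← integral_mul_const]
    refine integral_congr_ae ?_
    filter_upwards [compl_mem_ae_iff.2 (measure_singleton (0 : ℂ))] with v hv
    have hv : ‖v‖ ≠ 0 := norm_ne_zero_iff.2 hv
    rw [sub_self, norm_zero, max_eq_left (by positivity), max_eq_left (by positivity),
      Real.log_mul two_ne_zero hv]
    ring
  rw [h]
  exact mul_pos (integral_radialProfile_norm_pos hr) (Real.log_pos one_lt_two)

end Potential
/-! ### Geodesics confined by Cameron-Martin shifts -/

/-- There is a function of the form `∫ w, ψ w * log ‖z - w‖`, with `ψ` a test function of mean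
zero, which is nonnegative, positive on a given compact set, and supported in a given
neighbourhood of it. -/
theorem exists_logPotential {U K : Set ℂ} (hU : IsOpen U) (hK : IsCompact K) (hKU : K ⊆ U) :
    ∃ (ψ : ℂ → ℝ) (C : Set ℂ), ContDiff ℝ ((⊤ : ℕ∞) : WithTop ℕ∞) ψ ∧ HasCompactSupport ψ ∧
      ∫ w, ψ w = 0 ∧ IsCompact C ∧ C ⊆ U ∧ (∀ z, 0 ≤ ∫ w, ψ w * Real.log ‖z - w‖) ∧
      (∀ z ∈ K, 0 < ∫ w, ψ w * Real.log ‖z - w‖) ∧ ∀ z ∉ C, ∫ w, ψ w * Real.log ‖z - w‖ = 0 := by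
  -- Local bumps are added over a finite cover of `K`; nonnegativity is carried along so that adding
  -- one cannot destroy positivity.
  refine hK.induction_on (p := fun K => ∃ (ψ : ℂ → ℝ) (C : Set ℂ),
      ContDiff ℝ ((⊤ : ℕ∞) : WithTop ℕ∞) ψ ∧ HasCompactSupport ψ ∧
      ∫ w, ψ w = 0 ∧ IsCompact C ∧ C ⊆ U ∧ (∀ z, 0 ≤ ∫ w, ψ w * Real.log ‖z - w‖) ∧
      (∀ z ∈ K, 0 < ∫ w, ψ w * Real.log ‖z - w‖) ∧ ∀ z ∉ C, ∫ w, ψ w * Real.log ‖z - w‖ = 0)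
    ?_ ?_ ?_ ?_
  · exact ⟨0, ∅, contDiff_const, HasCompactSupport.zero, by simp, isCompact_empty,
      empty_subset _, by simp, by simp, by simp⟩
  · rintro s t hst ⟨ψ, C, h1, h2, h3, h4, h5, h6, h7, h8⟩
    exact ⟨ψ, C, h1, h2, h3, h4, h5, h6, fun z hz => h7 z (hst hz), h8⟩
  · rintro s t ⟨ψ, C, h1, h2, h3, h4, h5, h6, h7, h8⟩ ⟨ψ', C', h1', h2', h3', h4', h5', h6', h7', h8'⟩
    have hadd : ∀ z, ∫ w, (ψ + ψ') w * Real.log ‖z - w‖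
        = (∫ w, ψ w * Real.log ‖z - w‖) + ∫ w, ψ' w * Real.log ‖z - w‖ := fun z => by
      simp only [Pi.add_apply, add_mul]
      exact integral_add (integrable_mul_log_norm_sub h1.continuous h2 z)
        (integrable_mul_log_norm_sub h1'.continuous h2' z)
    refine ⟨ψ + ψ', C ∪ C', h1.add h1', h2.add h2', ?_, h4.union h4', union_subset h5 h5', ?_, ?_, ?_⟩
    · simp only [Pi.add_apply]
      rw [integral_add (h1.continuous.integrable_of_hasCompactSupport h2)
        (h1'.continuous.integrable_of_hasCompactSupport h2'), h3, h3', add_zero]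
    · intro z
      rw [hadd]
      exact add_nonneg (h6 z) (h6' z)
    · rintro z (hz | hz)
      · rw [hadd]
        exact add_pos_of_pos_of_nonneg (h7 z hz) (h6' z)
      · rw [hadd]
        exact add_pos_of_nonneg_of_pos (h6 z) (h7' z hz)
    · intro z hz
      rw [mem_union, not_or] at hz
      rw [hadd, h8 z hz.1, h8' z hz.2, add_zero]
  · intro a ha
    obtain ⟨ε, hε, hεU⟩ := Metric.nhds_basis_closedBall.mem_iff.1 (hU.mem_nhds (hKU ha))
    have hr : 0 < ε / 2 := half_pos hε
    refine ⟨{z | 0 < bump a (ε / 2) z}, mem_nhdsWithin_of_mem_nhds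
      ((isOpen_lt continuous_const (continuous_bump a hr)).mem_nhds (bump_self_pos a hr)),
      bumpSource a (ε / 2), Metric.closedBall a ε, contDiff_bumpSource _ _,
      hasCompactSupport_bumpSource a hr, integral_bumpSource a hr, isCompact_closedBall _ _, hεU,
      bump_nonneg a hr, fun z hz => hz, fun z hz => bump_eq_zero hr ?_⟩
    rw [Metric.mem_closedBall, not_le, dist_eq_norm] at hz
    linarith

theorem ofFun_smul (t : ℝ) (g : C(ℂ, ℝ)) : ofFun (t • g) = t • ofFun g := by
  ext φ
  show ofFun (t • g) φ = t * ofFun g φ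
  rw [ofFun_apply, ofFun_apply, ← integral_const_mul]
  simp only [ContinuousMap.smul_apply, smul_eq_mul, mul_left_comm]

theorem ofFun_zero : ofFun 0 = 0 := by
  simpa using ofFun_smul 0 0

section

variable {Ω : Type*} [MeasurableSpace Ω] {P : Measure Ω} {h : Ω → PlaneDistribution}

theorem IsWholePlaneGFF.isGFFPlusContinuous (hh : IsWholePlaneGFF h P) :
    IsGFFPlusContinuous h P :=
  ⟨h, fun _ => 0, hh, fun _ => measurable_const, fun ω => by simp [ofFun_zero]⟩

/-- The law of the free field shifted by a multiple of the Green potential of a test function of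
mean zero is absolutely continuous with respect to the law of the free field. -/
theorem IsWholePlaneGFF.map_add_ofFun_absolutelyContinuous [IsProbabilityMeasure P]
    (hh : IsWholePlaneGFF h P) {ψ : ℂ → ℝ} (hψ : ContDiff ℝ ((⊤ : ℕ∞) : WithTop ℕ∞) ψ)
    (hψs : HasCompactSupport ψ) (hψ0 : ∫ w, ψ w = 0) {g : C(ℂ, ℝ)}
    (hg : ∀ z, g z = (∫ w, ψ w * Real.log (max ‖w‖ 1)) - ∫ w, ψ w * Real.log ‖z - w‖) (t : ℝ) :
    P.map (fun ω => h ω + ofFun (t • g)) ≪ P.map h := by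
  let ψ' : PlaneTest := ⟨ψ, hψ, hψs, fun _ _ => trivial⟩
  simp only [ofFun_smul]
  refine hh.map_add_absolutelyContinuous (ψ := ψ') (fun φ => ?_) t
  rw [hh.covariance_eq, ofFun_apply]
  simp only [hg]
  exact integral_mul_mul_greenKernel φ.contDiff.continuous φ.hasCompactSupport hψ.continuous hψs hψ0

end

/-- The event that `w` is closer to `z` than all points of a set. -/
theorem measurableSet_exists_rat_lt {D : PlaneDistribution → ℂ → ℂ → ℝ}
    (hD : ∀ z w, Measurable fun T => D T z w) (z w : ℂ) {S : Set ℂ} (hS : S.Countable) :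
    MeasurableSet {T | ∃ q : ℚ, D T z w < q ∧ ∀ x ∈ S, (q : ℝ) ≤ D T z x} := by
  simp only [ofPred_exists, ofPred_and, ofPred_forall]
  exact MeasurableSet.iUnion fun q => (measurableSet_lt (hD z w) measurable_const).inter
    (MeasurableSet.biInter hS fun x _ => measurableSet_le measurable_const (hD z x))

/-- A connected open set contains a connected compact set joining two given points. -/
theorem exists_isCompact_isPreconnected {U : Set ℂ} (hUo : IsOpen U) (hUc : IsConnected U)
    {z w : ℂ} (hz : z ∈ U) (hw : w ∈ U) :
    ∃ K ⊆ U, IsCompact K ∧ IsPreconnected K ∧ z ∈ K ∧ w ∈ K := by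
  obtain ⟨γ, hγ⟩ := (hUo.isConnected_iff_isPathConnected.1 hUc).joinedIn z hz w hw
  exact ⟨range γ, range_subset_iff.2 hγ, isCompact_range γ.continuous,
    isPreconnected_range γ.continuous, ⟨0, γ.source⟩, ⟨1, γ.target⟩⟩

end LQG

theorem lemma4p1 {γ d : ℝ} (hγ₀ : 0 < γ) (hγ₂ : γ < 2) (hd : IsLQGDimension γ d)
    {D : PlaneDistribution → ℂ → ℂ → ℝ} (hD : IsLQGMetric.{u} γ d D)
    {Ω : Type u} [MeasurableSpace Ω] {P : Measure Ω} [IsProbabilityMeasure P]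
    {h : Ω → PlaneDistribution} (hh : IsWholePlaneGFF h P)
    {U : Set ℂ} (hUo : IsOpen U) (hUc : IsConnected U) {z w : ℂ} (hz : z ∈ U) (hw : w ∈ U) :
    ∃ A : Set Ω, MeasurableSet A ∧ 0 < P A ∧
      ∀ ω ∈ A, ∀ (p : ℝ → ℂ) (a b : ℝ), IsGeodesic (D (h ω)) p a b z w →
        ∀ t ∈ Icc a b, p t ∈ U := by
  have hξ : 0 < γ / d := div_pos hγ₀ hd.1
  obtain ⟨K, hKU, hKc, hKp, hzK, hwK⟩ := exists_isCompact_isPreconnected hUo hUc hz hw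
  obtain ⟨ψ, C, hψ, hψs, hψ0, hCc, hCU, -, hψK, hψC⟩ := exists_logPotential hUo hKc hKU
  -- This constant comes from the factor `max ‖w‖ 1` of the covariance kernel; its sign is
  -- irrelevant since distances are compared with `e^{ξ n c₀}`.
  set c₀ : ℝ := ∫ w, ψ w * Real.log (max ‖w‖ 1) with hc₀
  let g : C(ℂ, ℝ) := ⟨fun z => c₀ - ∫ w, ψ w * Real.log ‖z - w‖,
    continuous_const.sub (continuous_integral_mul_log_norm_sub hψ.continuous hψs)⟩
  have hg : ∀ z, g z = c₀ - ∫ w, ψ w * Real.log ‖z - w‖ := fun _ => rfl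
  obtain ⟨R, hR⟩ := hCc.isBounded.subset_ball 0
  -- Cutting `U` by a ball makes the frontier compact, hence at positive distance from `C`.
  set V : Set ℂ := U ∩ Metric.ball 0 R with hV
  have hVo : IsOpen V := hUo.inter Metric.isOpen_ball
  have hCV : C ⊆ V := subset_inter hCU hR
  have hFc : IsCompact (frontier V) := Metric.isCompact_of_isClosed_isBounded isClosed_frontier
    (((Metric.isBounded_ball (x := (0 : ℂ)) (r := R)).subset inter_subset_right).closure.subset
      frontier_subset_closure)
  have hFC : Disjoint (frontier V) C := by
    have := disjoint_frontier_iff_isOpen.2 hVo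
    exact this.mono_right hCV
  have hzV : z ∈ V := hCV (by
    by_contra hz'
    exact (hψK z hzK).ne' (hψC z hz'))
  -- A countable dense subset of the frontier, with a rational threshold, makes `E` measurable.
  obtain ⟨S, hSF, hSc, hFS⟩ := (IsSeparable.of_separableSpace (frontier V)).exists_countable_dense_subset
  set E : Set PlaneDistribution :=
    {T | ∃ q : ℚ, D T z w < q ∧ ∀ x ∈ S, (q : ℝ) ≤ D T z x} with hE
  have hEm : MeasurableSet E := measurableSet_exists_rat_lt hD.measurable z w hSc
  have hfm : ∀ n : ℕ, Measurable fun ω => h ω + ofFun ((n : ℝ) • g) := fun n =>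
    measurable_planeDistribution_iff.2 fun φ =>
      (measurable_planeDistribution_iff.1 hh.measurable φ).add_const _
  have hae : ∀ᵐ ω ∂P, ∃ n : ℕ, h ω + ofFun ((n : ℝ) • g) ∈ E := by
    filter_upwards [hD.weyl_scaling Ω P h hh.isGFFPlusContinuous] with ω hω
    have h0 : ∀ x y, weylScale (γ / d) 0 (D (h ω)) x y = ENNReal.ofReal (D (h ω) x y) :=
      fun x y => by rw [hω, ofFun_zero, add_zero]
    obtain ⟨n, q, hq, hqF⟩ := (eventually_lt_frontier
      (D := fun n => D (h ω + ofFun ((n : ℝ) • g))) hξ (hD.isPlaneMetric _)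
      (fun n => hD.isPlaneMetric _) h0 (fun n x y => hω _ x y) hKp
      (fun x hx => by rw [hg]; linarith [hψK x hx]) hCc.isClosed
      (fun x hx => by rw [hg, hψC x hx, sub_zero]) hFc hFC hzK hwK).exists
    exact ⟨n, q, hq, fun x hx => hqF x (hSF hx)⟩
  have hpos : 0 < P (h ⁻¹' E) := by
    rw [pos_iff_ne_zero]
    intro h0
    rw [← Measure.map_apply hh.measurable hEm] at h0
    have h1 : ∀ n : ℕ, ∀ᵐ ω ∂P, h ω + ofFun ((n : ℝ) • g) ∉ E := fun n => by
      have := hh.map_add_ofFun_absolutelyContinuous hψ hψs hψ0 hg n h0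
      rw [Measure.map_apply (hfm n) hEm] at this
      exact measure_eq_zero_iff_ae_notMem.1 this
    obtain ⟨ω, ⟨n, hn⟩, hω⟩ := (hae.and (ae_all_iff.2 h1)).exists
    exact hω n hn
  have hlen := hD.length_space Ω P h hh.isGFFPlusContinuous
  rw [ae_iff] at hlen
  -- The set where the length property fails is null but perhaps not measurable, so a measurable
  -- null superset is removed.
  refine ⟨h ⁻¹' E \ toMeasurable P {ω | ¬ IsLengthMetric (D (h ω))},
    (hh.measurable hEm).diff (measurableSet_toMeasurable _ _), ?_, ?_⟩
  · rwa [measure_sdiff_null ((measure_toMeasurable _).trans hlen)]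
  · rintro ω ⟨⟨q, hq, hqS⟩, hω⟩ p a b hp t ht
    have hl : IsLengthMetric (D (h ω)) := by
      by_contra hl
      exact hω (subset_toMeasurable _ _ hl)
    exact (hp.mem_of_lt_frontier (hD.isPlaneMetric _) hl hzV hq
      ((hD.isPlaneMetric _).le_of_dense hFS hqS) ht).1
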